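/- **Model.** Let $L,R$ be finite sets with $|L|=n_L$, $|R|=n_R$, carrying nonnegative weights $S_L=(w_u)_{u\in L}$ and $S_R=(w_v)_{v\in R}$ with $\sum_{v\in R}w_v>0$. Let $G_b=(L\sqcup R,E_b)$ be the random bipartite graph whose edges are independent, with $$\Pr[(u,v)\in E_b]=\min\Big(\frac{w_uw_v}{\sum_{z\in R}w_z},\,1\Big),\qquad u\in L,\ v\in R.$$ The projected graph $G=(L,E)$ joins two distinct left nodes if and only if they have a common neighbour in $R$. Write $M_{Rk}=\frac1{n_R}\sum_{v\in R}w_v^k$. For $u\in L$, the conditional local clustering coefficient is $$C(u)=\Pr\big[(v,w)\in E\ \big|\ (u,v)\in E,\ (u,w)\in E\big],$$ where $(v,w)$ is a uniformly random ordered pair of distinct nodes of $L\setminus\{u\}$, independent of $G_b$. **Theorem.** Consider a family of such weight sequences with $n_L,n_R\to\infty$ (no relation between $n_L$ and $n_R$ is assumed), and suppose that for some constant $\delta>\frac1{10}$ $$\max[S_L,S_R]=O\big(n_R^{1/2-\delta}\big),\quad \min[S_L]=\Omega(1),\quad M_{R2}=O\big(M_{R1}^2\big),\quad M_{R4}=O\big(n_R^{1-2\delta}\big).$$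 Then, for the given (deterministic) weight sequences, $$C(u)=\frac{1}{1+\frac{M_{R2}^2}{M_{R3}M_{R1}}\,w_u}+o(1)\qquad\text{uniformly in }u\in L,$$ that is, for every $\varepsilon>0$, for all sufficiently late members of the family and every $u\in L$, the two sides differ by less than $\varepsilon$. -/

import Mathlib

open MeasureTheory ProbabilityTheory Filter Asymptotics
open scoped Topology

noncomputable section

namespace BipartiteProjection

/-- The `k`-th moment `(1 / n) ∑ w_v ^ k` of a weight sequence of length `n`. -/
def weightMoment {n : ℕ} (w : Fin n → ℝ) (k : ℕ) : ℝ :=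
  (∑ v, w v ^ k) / n

/-- The probability that the left node `u` and the right node `v` are joined in the random bipartite
graph: the projection of `w_u w_v / ∑_z w_z` to the unit interval, with `z` ranging over the right
nodes. For nonnegative weights this is `min (w_u w_v / ∑_z w_z) 1`. -/
def edgeProb {nL nR : ℕ} (wL : Fin nL → ℝ) (wR : Fin nR → ℝ) (u : Fin nL) (v : Fin nR) :
    unitInterval :=
  Set.projIcc (0 : ℝ) 1 zero_le_one (wL u * wR v / ∑ z, wR z)

/-- A bipartite graph with left nodes `Fin nL` and right nodes `Fin nR`, given by the indicator
function of its edge set. -/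
abbrev BipGraph (nL nR : ℕ) : Type := Fin nL × Fin nR → Bool

/-- The Chung-Lu style random bipartite graph with weights `wL`, `wR`: all possible edges are
independent, and `(u, v)` is present with probability `edgeProb wL wR u v`. -/
def chungLu {nL nR : ℕ} (wL : Fin nL → ℝ) (wR : Fin nR → ℝ) : Measure (BipGraph nL nR) :=
  Measure.pi fun e => bernoulliMeasure true false (edgeProb wL wR e.1 e.2)

/-- The projection of a bipartite graph to its left nodes: two distinct left nodes are adjacent
when they have a common right neighbour. -/
def projection {nL nR : ℕ} (H : BipGraph nL nR) : SimpleGraph (Fin nL) where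
  Adj u v := u ≠ v ∧ ∃ z, H (u, z) = true ∧ H (v, z) = true
  symm := ⟨fun _ _ h => ⟨h.1.symm, h.2.imp fun _ hz => hz.symm⟩⟩
  loopless := ⟨fun _ h => h.1 rfl⟩

/-- The joint law of the random bipartite graph and of an independent uniformly random ordered
pair of distinct left nodes, both different from `u`. -/
def pairLaw {nL nR : ℕ} (wL : Fin nL → ℝ) (wR : Fin nR → ℝ) (u : Fin nL) :
    Measure (BipGraph nL nR × (Fin nL × Fin nL)) :=
  (chungLu wL wR).prod (uniformOn {p : Fin nL × Fin nL | p.1 ≠ p.2 ∧ p.1 ≠ u ∧ p.2 ≠ u})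

/-- The event that the random pair `(v, w)` forms a wedge centered at `u` in the projection. -/
def wedgeEvent {nL : ℕ} (nR : ℕ) (u : Fin nL) : Set (BipGraph nL nR × (Fin nL × Fin nL)) :=
  {x | (projection x.1).Adj u x.2.1 ∧ (projection x.1).Adj u x.2.2}

/-- The event that the two nodes of the random pair `(v, w)` are adjacent in the projection. -/
def closedEvent (nL nR : ℕ) : Set (BipGraph nL nR × (Fin nL × Fin nL)) :=
  {x | (projection x.1).Adj x.2.1 x.2.2}

/-- The conditional local clustering coefficient
`C(u) = P((v, w) ∈ E | (u, v) ∈ E, (u, w) ∈ E)` of the left node `u` in the projected graph, for a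
random pair `(v, w)`. -/
def localClustering {nL nR : ℕ} (wL : Fin nL → ℝ) (wR : Fin nR → ℝ) (u : Fin nL) : ℝ :=
  (cond (pairLaw wL wR u) (wedgeEvent nR u)).real (closedEvent nL nR)

/-- The bounded weight assumption with parameter `δ`, for a family of weight sequences in the
limit along `l`. -/
structure BoundedWeights {ι : Type*} (l : Filter ι) {nL nR : ι → ℕ}
    (wL : ∀ i, Fin (nL i) → ℝ) (wR : ∀ i, Fin (nR i) → ℝ) (δ : ℝ) : Prop where
  /-- `max [S_L, S_R] = O(n_R ^ (1/2 - δ))` -/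
  range_max : (fun i => max (⨆ u, wL i u) (⨆ v, wR i v)) =O[l]
    fun i => (nR i : ℝ) ^ (1 / 2 - δ)
  /-- `min [S_L] = Ω(1)` -/
  left_min : (fun _ => (1 : ℝ)) =O[l] fun i => ⨅ u, wL i u
  /-- `M_{R2} = O(M_{R1} ^ 2)` -/
  moment_two : (fun i => weightMoment (wR i) 2) =O[l] fun i => weightMoment (wR i) 1 ^ 2
  /-- `M_{R4} = O(n_R ^ (1 - 2 δ))` -/
  moment_four : (fun i => weightMoment (wR i) 4) =O[l] fun i => (nR i : ℝ) ^ (1 - 2 * δ)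

end BipartiteProjection

end

open BipartiteProjection

/-! Put `a z = wR z / ∑ v, wR v` and `Sₖ = ∑ z, a z ^ k`. Two mechanisms produce a wedge `v - u -
w`: one right node joined to all three, of expected number `A = w_u w_v w_w S₃`, or two distinct
right nodes, of expected number about `B = w_u² w_v w_w S₂²`. The first closes the wedge
automatically; the second rarely does. So the triangle and wedge probabilities are about `A` and `A
+ B`, and in `A / (A + B) = S₃ / (S₃ + w_u S₂²)` the weights of `v` and `w` cancel. As the ratio
depends on `u` only, averaging over pairs preserves it.

First-moment bounds give the upper estimates and Bonferroni-type inequalities the lower ones. All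
errors are small relative to `A` or `B` once `W² S₂ ≤ η²`, where `W` bounds the left weights
(`measureReal_triangleAt_sub_le`); `abs_localClustering_sub_le` averages over pairs. Finally `W² S₂
= O(n_R ^ (-2δ))` (`tendsto_max_sq_mul_sum_sq`), which gives uniformity in `u`. -/

namespace BipartiteProjection

/-! ### Expectations of products of edge indicators. -/

section Expectations

variable {nL nR : ℕ} {wL : Fin nL → ℝ} {wR : Fin nR → ℝ}

instance (wL : Fin nL → ℝ) (wR : Fin nR → ℝ) : IsProbabilityMeasure (chungLu wL wR) := by
  unfold chungLu
  infer_instance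

/-- The indicator of the presence of the edge `(u, z)`, as a real number. -/
def edgeInd (H : BipGraph nL nR) (u : Fin nL) (z : Fin nR) : ℝ :=
  if H (u, z) = true then 1 else 0

lemma edgeInd_eq_zero_or_one (H : BipGraph nL nR) (u : Fin nL) (z : Fin nR) :
    edgeInd H u z = 0 ∨ edgeInd H u z = 1 := by
  unfold edgeInd
  split_ifs <;> simp

lemma edgeInd_nonneg (H : BipGraph nL nR) (u : Fin nL) (z : Fin nR) : 0 ≤ edgeInd H u z := by
  rcases edgeInd_eq_zero_or_one H u z with h | h <;> simp [h]

lemma edgeInd_of_mem {H : BipGraph nL nR} {u : Fin nL} {z : Fin nR} (h : H (u, z) = true) :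
    edgeInd H u z = 1 := by
  simp [edgeInd, h]

/-- Distinct edges are independent: the expectation of a product of edge indicators. -/
lemma integral_prod_edgeInd (S : Finset (Fin nL × Fin nR)) :
    ∫ H, ∏ e ∈ S, edgeInd H e.1 e.2 ∂chungLu wL wR =
      ∏ e ∈ S, (edgeProb wL wR e.1 e.2 : ℝ) := by
  have h := integral_fintype_prod_eq_prod (𝕜 := ℝ)
    (μ := fun e : Fin nL × Fin nR => bernoulliMeasure true false (edgeProb wL wR e.1 e.2))
    (fun e b => if e ∈ S then (if b = true then (1 : ℝ) else 0) else 1)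
  have hE (e : Fin nL × Fin nR) : (∫ b, (if e ∈ S then (if b = true then (1 : ℝ) else 0) else 1)
      ∂bernoulliMeasure true false (edgeProb wL wR e.1 e.2)) =
      if e ∈ S then (edgeProb wL wR e.1 e.2 : ℝ) else 1 := by
    rw [integral_bernoulliMeasure]
    split_ifs <;> simp_all
  simp only [hE, Finset.prod_ite_mem, Finset.univ_inter] at h
  exact h

lemma edgeInd_mul_self (H : BipGraph nL nR) (u : Fin nL) (z : Fin nR) :
    edgeInd H u z * edgeInd H u z = edgeInd H u z := by
  rcases edgeInd_eq_zero_or_one H u z with h | h <;> simp [h]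

variable {a : Fin nR → ℝ} {u v w : Fin nL}

/-- The probability that three left nodes are all joined to `z`. -/
lemma integral_star (hp : ∀ u z, (edgeProb wL wR u z : ℝ) = wL u * a z)
    (huv : u ≠ v) (huw : u ≠ w) (hvw : v ≠ w) (z : Fin nR) :
    ∫ H, edgeInd H u z * edgeInd H v z * edgeInd H w z ∂chungLu wL wR =
      wL u * wL v * wL w * a z ^ 3 := by
  have h := integral_prod_edgeInd (wL := wL) (wR := wR) {(u, z), (v, z), (w, z)}
  simp [huv, huw, hvw, hp, ← mul_assoc] at h
  rw [h]; ring

lemma integral_star_mul_star (hp : ∀ u z, (edgeProb wL wR u z : ℝ) = wL u * a z)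
    (huv : u ≠ v) (huw : u ≠ w) (hvw : v ≠ w) {z z' : Fin nR} (hz : z ≠ z') :
    ∫ H, (edgeInd H u z * edgeInd H v z * edgeInd H w z) *
      (edgeInd H u z' * edgeInd H v z' * edgeInd H w z') ∂chungLu wL wR =
      (wL u * wL v * wL w * a z ^ 3) * (wL u * wL v * wL w * a z' ^ 3) := by
  have h := integral_prod_edgeInd (wL := wL) (wR := wR)
    {(u, z), (v, z), (w, z), (u, z'), (v, z'), (w, z')}
  simp [huv, huw, hvw, hz, hp, ← mul_assoc] at h
  simp only [← mul_assoc]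
  rw [h]; ring

/-- The probability of a wedge `v - z - u - z' - w`. -/
lemma integral_path (hp : ∀ u z, (edgeProb wL wR u z : ℝ) = wL u * a z)
    (huv : u ≠ v) (huw : u ≠ w) (hvw : v ≠ w) (z z' : Fin nR) :
    ∫ H, edgeInd H u z * edgeInd H v z * (edgeInd H u z' * edgeInd H w z') ∂chungLu wL wR =
      if z = z' then wL u * wL v * wL w * a z ^ 3
        else wL u ^ 2 * wL v * wL w * (a z ^ 2 * a z' ^ 2) := by
  split_ifs with hz
  · subst hz
    rw [← integral_star hp huv huw hvw z]
    congr 1 with H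
    linear_combination edgeInd H v z * edgeInd H w z * edgeInd_mul_self H u z
  · have h := integral_prod_edgeInd (wL := wL) (wR := wR) {(u, z), (v, z), (u, z'), (w, z')}
    simp [huv, huw, hvw, hz, hp, ← mul_assoc] at h
    simp only [← mul_assoc]
    rw [h]; ring

lemma integral_triangle (hp : ∀ u z, (edgeProb wL wR u z : ℝ) = wL u * a z)
    (huv : u ≠ v) (huw : u ≠ w) (hvw : v ≠ w) {z₁ z₂ z₃ : Fin nR}
    (h12 : z₁ ≠ z₂) (h13 : z₁ ≠ z₃) (h23 : z₂ ≠ z₃) :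
    ∫ H, (edgeInd H u z₁ * edgeInd H v z₁) * (edgeInd H u z₂ * edgeInd H w z₂) *
      (edgeInd H v z₃ * edgeInd H w z₃) ∂chungLu wL wR =
      (wL u * wL v * wL w) ^ 2 * (a z₁ ^ 2 * a z₂ ^ 2 * a z₃ ^ 2) := by
  have h := integral_prod_edgeInd (wL := wL) (wR := wR)
    {(u, z₁), (v, z₁), (u, z₂), (w, z₂), (v, z₃), (w, z₃)}
  simp [huv, huw, hvw, h12, h13, h23, hp, ← mul_assoc] at h
  simp only [← mul_assoc]
  rw [h]; ring

/-- If `z₃` coincides with `z₁` or `z₂`, the two copies of an edge at `u` merge and one factor `wL u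
* a` is lost. The generic term is kept in every case, so that the bound sums to a product of power
sums. -/
lemma integral_double_path_le (hp : ∀ u z, (edgeProb wL wR u z : ℝ) = wL u * a z)
    (hw : ∀ u, 0 ≤ wL u) (ha : ∀ z, 0 ≤ a z)
    (huv : u ≠ v) (huw : u ≠ w) (hvw : v ≠ w) {z₁ z₂ z₃ : Fin nR} (h12 : z₁ ≠ z₂) :
    ∫ H, (edgeInd H u z₁ * edgeInd H v z₁) * (edgeInd H u z₂ * edgeInd H v z₂) *
      (edgeInd H u z₃ * edgeInd H w z₃) ∂chungLu wL wR ≤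
      (if z₁ = z₃ then wL u ^ 2 * wL v ^ 2 * wL w * (a z₁ ^ 3 * a z₂ ^ 2) else 0) +
      (if z₂ = z₃ then wL u ^ 2 * wL v ^ 2 * wL w * (a z₁ ^ 2 * a z₂ ^ 3) else 0) +
      wL u ^ 3 * wL v ^ 2 * wL w * (a z₁ ^ 2 * a z₂ ^ 2 * a z₃ ^ 2) := by
  have hu := hw u
  have hv := hw v
  have hw := hw w
  have h1 := ha z₁
  have h2 := ha z₂
  have h3 := ha z₃
  by_cases h13 : z₁ = z₃
  · subst h13
    have h := integral_prod_edgeInd (wL := wL) (wR := wR)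
      {(u, z₁), (v, z₁), (w, z₁), (u, z₂), (v, z₂)}
    simp [huv, huw, hvw, h12, hp, ← mul_assoc] at h
    have h' : ∫ H, (edgeInd H u z₁ * edgeInd H v z₁) * (edgeInd H u z₂ * edgeInd H v z₂) *
        (edgeInd H u z₁ * edgeInd H w z₁) ∂chungLu wL wR =
        wL u ^ 2 * wL v ^ 2 * wL w * (a z₁ ^ 3 * a z₂ ^ 2) := by
      trans
      swap
      · trans
        · exact h
        · ring
      congr 1 with H
      linear_combination edgeInd H v z₁ * edgeInd H w z₁ * edgeInd H u z₂ * edgeInd H v z₂ *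
        edgeInd_mul_self H u z₁
    rw [h', if_pos rfl, if_neg h12.symm, add_zero]
    exact le_add_of_nonneg_right (by positivity)
  by_cases h23 : z₂ = z₃
  · subst h23
    have h := integral_prod_edgeInd (wL := wL) (wR := wR)
      {(u, z₁), (v, z₁), (u, z₂), (v, z₂), (w, z₂)}
    simp [huv, huw, hvw, h12, hp, ← mul_assoc] at h
    have h' : ∫ H, (edgeInd H u z₁ * edgeInd H v z₁) * (edgeInd H u z₂ * edgeInd H v z₂) *
        (edgeInd H u z₂ * edgeInd H w z₂) ∂chungLu wL wR =
        wL u ^ 2 * wL v ^ 2 * wL w * (a z₁ ^ 2 * a z₂ ^ 3) := by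
      trans
      swap
      · trans
        · exact h
        · ring
      congr 1 with H
      linear_combination edgeInd H u z₁ * edgeInd H v z₁ * edgeInd H v z₂ * edgeInd H w z₂ *
        edgeInd_mul_self H u z₂
    rw [h', if_pos rfl, if_neg h12, zero_add]
    exact le_add_of_nonneg_right (by positivity)
  · have h := integral_prod_edgeInd (wL := wL) (wR := wR)
      {(u, z₁), (v, z₁), (u, z₂), (v, z₂), (u, z₃), (w, z₃)}
    simp [huv, huw, hvw, h12, h13, h23, hp, ← mul_assoc] at h
    simp only [← mul_assoc]
    rw [h, if_neg h13, if_neg h23]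
    apply le_of_eq
    ring

end Expectations

end BipartiteProjection

namespace BipartiteProjection

/-! ### Bonferroni-type inequalities for 0-1 sums. -/

section Counting

variable {α : Type*} [Fintype α] {g : α → ℝ}

lemma sum_mul_sum_sub_one [DecidableEq α] (hg : ∀ z, g z = 0 ∨ g z = 1) :
    (∑ z, g z) * (∑ z, g z - 1) = ∑ z, ∑ z', if z = z' then 0 else g z * g z' := by
  have h (z z' : α) : (if z = z' then 0 else g z * g z') =
      g z * g z' - if z = z' then g z else 0 := by
    split_ifs with hz
    · subst hz
      rcases hg z with h | h <;> simp [h]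
    · simp
  simp only [h, Finset.sum_sub_distrib, Finset.sum_ite_eq, Finset.mem_univ, if_true,
    ← Finset.mul_sum, ← Finset.sum_mul]
  ring

lemma exists_nat_eq_sum (hg : ∀ z, g z = 0 ∨ g z = 1) : ∃ k : ℕ, ∑ z, g z = k := by
  refine ⟨∑ z, if g z = 1 then 1 else 0, ?_⟩
  push_cast
  refine Finset.sum_congr rfl fun z _ => ?_
  rcases hg z with h | h <;> simp [h]

lemma nat_sub_choose_two_le_one (k : ℕ) : (k : ℝ) - k * (k - 1) / 2 ≤ 1 := by
  obtain h | h : k ≤ 1 ∨ 2 ≤ k := by omega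
  · interval_cases k <;> norm_num
  · have : (2 : ℝ) ≤ k := by exact_mod_cast h
    nlinarith

/-- Bonferroni for a product of two counts. The left side is `k m (4 - (k + m)) / 2`, positive only
when `k + m ≤ 3`, which leaves finitely many cases. -/
lemma nat_mul_sub_le_one (k m : ℕ) :
    (k : ℝ) * m - (k * (k - 1) * m + m * (m - 1) * k) / 2 ≤ 1 := by
  obtain rfl | hk := Nat.eq_zero_or_pos k
  · simp
  obtain rfl | hm := Nat.eq_zero_or_pos m
  · simp
  have e : (k : ℝ) * m - (k * (k - 1) * m + m * (m - 1) * k) / 2 =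
      k * m * (4 - (k + m)) / 2 := by ring
  rw [e]
  obtain h | h : k + m ≤ 3 ∨ 4 ≤ k + m := by omega
  · have : k ≤ 2 := by omega
    have : m ≤ 2 := by omega
    interval_cases k <;> interval_cases m <;> first | omega | norm_num
  · have : (4 : ℝ) ≤ k + m := by exact_mod_cast h
    have : (0 : ℝ) ≤ k * m := by positivity
    nlinarith

end Counting

/-! ### Comparing probabilities with expectations. -/

section Indicator

variable {Ω : Type*} [Finite Ω] [MeasurableSpace Ω] [MeasurableSingletonClass Ω]
  {μ : Measure Ω} [IsFiniteMeasure μ] {s : Set Ω} {f : Ω → ℝ}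

lemma measureReal_le_integral (hs : ∀ x ∈ s, 1 ≤ f x) (hf : ∀ x, 0 ≤ f x) :
    μ.real s ≤ ∫ x, f x ∂μ := by
  rw [← integral_indicator_one s.toFinite.measurableSet]
  refine integral_mono .of_finite .of_finite fun x => ?_
  by_cases hx : x ∈ s
  · simpa [hx] using hs x hx
  · simpa [hx] using hf x

lemma integral_le_measureReal (hs : ∀ x ∈ s, f x ≤ 1) (hf : ∀ x ∉ s, f x ≤ 0) :
    ∫ x, f x ∂μ ≤ μ.real s := by
  rw [← integral_indicator_one s.toFinite.measurableSet]
  refine integral_mono .of_finite .of_finite fun x => ?_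
  by_cases hx : x ∈ s
  · simpa [hx] using hs x hx
  · simpa [hx] using hf x hx

end Indicator

/-! ### Wedge and triangle probabilities for a fixed triple. -/

section Bounds

variable {nL nR : ℕ} {wL : Fin nL → ℝ} {wR : Fin nR → ℝ} {u v w : Fin nL}

/-- The number of common right neighbours of `u` and `v`. -/
def commonNbrs (H : BipGraph nL nR) (u v : Fin nL) : ℝ :=
  ∑ z, edgeInd H u z * edgeInd H v z

lemma edgeInd_mul_eq_zero_or_one (H : BipGraph nL nR) (u v : Fin nL) (z : Fin nR) :
    edgeInd H u z * edgeInd H v z = 0 ∨ edgeInd H u z * edgeInd H v z = 1 := by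
  rcases edgeInd_eq_zero_or_one H u z with h | h <;>
    rcases edgeInd_eq_zero_or_one H v z with h' | h' <;> simp [h, h']

lemma edgeInd_mul_mul_eq_zero_or_one (H : BipGraph nL nR) (u v w : Fin nL) (z : Fin nR) :
    edgeInd H u z * edgeInd H v z * edgeInd H w z = 0 ∨
      edgeInd H u z * edgeInd H v z * edgeInd H w z = 1 := by
  rcases edgeInd_mul_eq_zero_or_one H u v z with h | h <;>
    rcases edgeInd_eq_zero_or_one H w z with h' | h' <;> simp [h, h']

lemma commonNbrs_nonneg (H : BipGraph nL nR) (u v : Fin nL) : 0 ≤ commonNbrs H u v :=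
  Finset.sum_nonneg fun z _ => mul_nonneg (edgeInd_nonneg H u z) (edgeInd_nonneg H v z)

lemma one_le_commonNbrs {H : BipGraph nL nR} (h : (projection H).Adj u v) :
    1 ≤ commonNbrs H u v := by
  obtain ⟨z, hz, hz'⟩ := h.2
  have := Finset.single_le_sum (f := fun z => edgeInd H u z * edgeInd H v z)
    (fun z _ => mul_nonneg (edgeInd_nonneg H u z) (edgeInd_nonneg H v z)) (Finset.mem_univ z)
  simpa [commonNbrs, edgeInd_of_mem hz, edgeInd_of_mem hz'] using this

lemma commonNbrs_eq_zero {H : BipGraph nL nR} (huv : u ≠ v) (h : ¬ (projection H).Adj u v) :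
    commonNbrs H u v = 0 := by
  refine Finset.sum_eq_zero fun z _ => ?_
  by_contra hz
  refine h ⟨huv, z, ?_, ?_⟩ <;> by_contra hH <;> exact hz (by simp [edgeInd, hH])

/-- The event that `v - u - w` is a wedge in the projection. -/
def wedgeAt (nR : ℕ) (u v w : Fin nL) : Set (BipGraph nL nR) :=
  {H | (projection H).Adj u v ∧ (projection H).Adj u w}

/-- The event that `u`, `v`, `w` form a triangle in the projection. -/
def triangleAt (nR : ℕ) (u v w : Fin nL) : Set (BipGraph nL nR) :=
  {H | ((projection H).Adj u v ∧ (projection H).Adj u w) ∧ (projection H).Adj v w}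

variable {a : Fin nR → ℝ}

/-- The diagonal `z = z'` contributes the `a ^ 3` term; completing the off-diagonal sum to a full
square costs the `a ^ 4` term. -/
lemma integral_commonNbrs_mul (hp : ∀ u z, (edgeProb wL wR u z : ℝ) = wL u * a z)
    (huv : u ≠ v) (huw : u ≠ w) (hvw : v ≠ w) :
    ∫ H, commonNbrs H u v * commonNbrs H u w ∂chungLu wL wR =
      wL u * wL v * wL w * ∑ z, a z ^ 3 + wL u ^ 2 * wL v * wL w * (∑ z, a z ^ 2) ^ 2 -
        wL u ^ 2 * wL v * wL w * ∑ z, a z ^ 4 := by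
  simp only [commonNbrs, Finset.sum_mul_sum]
  rw [integral_finsetSum _ fun _ _ => .of_finite]
  have h (z z' : Fin nR) : (if z = z' then wL u * wL v * wL w * a z ^ 3
        else wL u ^ 2 * wL v * wL w * (a z ^ 2 * a z' ^ 2)) =
      wL u ^ 2 * wL v * wL w * (a z ^ 2 * a z' ^ 2) +
      if z = z' then wL u * wL v * wL w * a z ^ 3 - wL u ^ 2 * wL v * wL w * a z ^ 4 else 0 := by
    split_ifs with hz
    · subst hz; ring
    · simp
  simp_rw [fun z => integral_finsetSum (μ := chungLu wL wR) Finset.univ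
    (f := fun z' H => edgeInd H u z * edgeInd H v z * (edgeInd H u z' * edgeInd H w z'))
    fun _ _ => .of_finite, integral_path hp huv huw hvw, h, Finset.sum_add_distrib,
    Finset.sum_ite_eq, Finset.mem_univ, if_true, ← Finset.mul_sum, Finset.sum_sub_distrib,
    ← Finset.mul_sum, ← Finset.sum_mul]
  ring

lemma integral_commonNbrs_pairs_le (hp : ∀ u z, (edgeProb wL wR u z : ℝ) = wL u * a z)
    (hw : ∀ u, 0 ≤ wL u) (ha : ∀ z, 0 ≤ a z)
    (huv : u ≠ v) (huw : u ≠ w) (hvw : v ≠ w) :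
    ∫ H, commonNbrs H u v * (commonNbrs H u v - 1) * commonNbrs H u w ∂chungLu wL wR ≤
      2 * (wL u ^ 2 * wL v ^ 2 * wL w * ((∑ z, a z ^ 3) * ∑ z, a z ^ 2)) +
        wL u ^ 3 * wL v ^ 2 * wL w * (∑ z, a z ^ 2) ^ 3 := by
  have e (H : BipGraph nL nR) :
      commonNbrs H u v * (commonNbrs H u v - 1) * commonNbrs H u w =
        ∑ z₁, ∑ z₂, ∑ z₃, if z₁ = z₂ then 0 else
          (edgeInd H u z₁ * edgeInd H v z₁) * (edgeInd H u z₂ * edgeInd H v z₂) *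
          (edgeInd H u z₃ * edgeInd H w z₃) := by
    rw [commonNbrs, sum_mul_sum_sub_one (edgeInd_mul_eq_zero_or_one H u v), commonNbrs,
      Finset.sum_mul]
    refine Finset.sum_congr rfl fun z₁ _ => ?_
    rw [Finset.sum_mul]
    refine Finset.sum_congr rfl fun z₂ _ => ?_
    rw [Finset.mul_sum]
    refine Finset.sum_congr rfl fun z₃ _ => ?_
    split_ifs <;> simp
  simp_rw [e]
  rw [integral_finsetSum _ fun _ _ => .of_finite]
  have hb : ∑ z₁, ∑ z₂, ∑ z₃,
      ((if z₁ = z₃ then wL u ^ 2 * wL v ^ 2 * wL w * (a z₁ ^ 3 * a z₂ ^ 2) else 0) +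
      (if z₂ = z₃ then wL u ^ 2 * wL v ^ 2 * wL w * (a z₁ ^ 2 * a z₂ ^ 3) else 0) +
      wL u ^ 3 * wL v ^ 2 * wL w * (a z₁ ^ 2 * a z₂ ^ 2 * a z₃ ^ 2)) =
      2 * (wL u ^ 2 * wL v ^ 2 * wL w * ((∑ z, a z ^ 3) * ∑ z, a z ^ 2)) +
        wL u ^ 3 * wL v ^ 2 * wL w * (∑ z, a z ^ 2) ^ 3 := by
    simp only [Finset.sum_add_distrib, Finset.sum_ite_eq, Finset.mem_univ, if_true,
      ← Finset.mul_sum, ← Finset.sum_mul]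
    ring
  rw [← hb]
  refine Finset.sum_le_sum fun z₁ _ => ?_
  rw [integral_finsetSum _ fun _ _ => .of_finite]
  refine Finset.sum_le_sum fun z₂ _ => ?_
  rw [integral_finsetSum _ fun _ _ => .of_finite]
  refine Finset.sum_le_sum fun z₃ _ => ?_
  by_cases h12 : z₁ = z₂
  · have hu := hw u
    have hv := hw v
    have hw := hw w
    have h1 := ha z₁
    have h2 := ha z₂
    have h3 := ha z₃
    simp only [h12, if_true, integral_zero]
    split_ifs <;> positivity
  · simp only [if_neg h12]
    exact integral_double_path_le hp hw ha huv huw hvw h12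

lemma measureReal_wedgeAt_le (hp : ∀ u z, (edgeProb wL wR u z : ℝ) = wL u * a z)
    (hw : ∀ u, 0 ≤ wL u) (huv : u ≠ v) (huw : u ≠ w) (hvw : v ≠ w) :
    (chungLu wL wR).real (wedgeAt nR u v w) ≤
      wL u * wL v * wL w * ∑ z, a z ^ 3 + wL u ^ 2 * wL v * wL w * (∑ z, a z ^ 2) ^ 2 := by
  have h : (chungLu wL wR).real (wedgeAt nR u v w) ≤
      ∫ H, commonNbrs H u v * commonNbrs H u w ∂chungLu wL wR :=
    measureReal_le_integral
      (fun H hH => one_le_mul_of_one_le_of_one_le (one_le_commonNbrs hH.1) (one_le_commonNbrs hH.2))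
      fun H => mul_nonneg (commonNbrs_nonneg H u v) (commonNbrs_nonneg H u w)
  rw [integral_commonNbrs_mul hp huv huw hvw] at h
  refine h.trans (sub_le_self _ ?_)
  have hu := hw u
  have hv := hw v
  have hw := hw w
  have : 0 ≤ ∑ z, a z ^ 4 := Finset.sum_nonneg fun z _ => by positivity
  positivity

/-- Integrates the inequality of `nat_mul_sub_le_one`, applied to the two common-neighbour counts.
-/
lemma le_measureReal_wedgeAt (hp : ∀ u z, (edgeProb wL wR u z : ℝ) = wL u * a z)
    (hw : ∀ u, 0 ≤ wL u) (ha : ∀ z, 0 ≤ a z)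
    (huv : u ≠ v) (huw : u ≠ w) (hvw : v ≠ w) :
    wL u * wL v * wL w * ∑ z, a z ^ 3 + wL u ^ 2 * wL v * wL w * (∑ z, a z ^ 2) ^ 2 -
        wL u ^ 2 * wL v * wL w * ∑ z, a z ^ 4 -
      ((2 * (wL u ^ 2 * wL v ^ 2 * wL w * ((∑ z, a z ^ 3) * ∑ z, a z ^ 2)) +
        wL u ^ 3 * wL v ^ 2 * wL w * (∑ z, a z ^ 2) ^ 3) +
      (2 * (wL u ^ 2 * wL w ^ 2 * wL v * ((∑ z, a z ^ 3) * ∑ z, a z ^ 2)) +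
        wL u ^ 3 * wL w ^ 2 * wL v * (∑ z, a z ^ 2) ^ 3)) / 2 ≤
      (chungLu wL wR).real (wedgeAt nR u v w) := by
  have h : ∫ H, (commonNbrs H u v * commonNbrs H u w -
      (commonNbrs H u v * (commonNbrs H u v - 1) * commonNbrs H u w +
        commonNbrs H u w * (commonNbrs H u w - 1) * commonNbrs H u v) / 2) ∂chungLu wL wR ≤
      (chungLu wL wR).real (wedgeAt nR u v w) := by
    refine integral_le_measureReal (fun H _ => ?_) fun H hH => ?_
    · obtain ⟨k, hk⟩ := exists_nat_eq_sum (edgeInd_mul_eq_zero_or_one H u v)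
      obtain ⟨m, hm⟩ := exists_nat_eq_sum (edgeInd_mul_eq_zero_or_one H u w)
      rw [commonNbrs, hk, commonNbrs, hm]
      exact nat_mul_sub_le_one k m
    · rcases not_and_or.mp hH with h | h
      · simp [commonNbrs_eq_zero huv h]
      · simp [commonNbrs_eq_zero huw h]
  rw [integral_sub .of_finite .of_finite, integral_div, integral_add .of_finite .of_finite,
    integral_commonNbrs_mul hp huv huw hvw] at h
  have h1 := integral_commonNbrs_pairs_le hp hw ha huv huw hvw
  have h2 := integral_commonNbrs_pairs_le hp hw ha huw huv hvw.symm
  linarith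

/-- Counts only right nodes joined to all three left nodes, and applies Bonferroni. Stars at
distinct right nodes are independent, so the pair term is at most the square of the mean. -/
lemma le_measureReal_triangleAt (hp : ∀ u z, (edgeProb wL wR u z : ℝ) = wL u * a z)
    (huv : u ≠ v) (huw : u ≠ w) (hvw : v ≠ w) :
    wL u * wL v * wL w * ∑ z, a z ^ 3 - (wL u * wL v * wL w * ∑ z, a z ^ 3) ^ 2 / 2 ≤
      (chungLu wL wR).real (triangleAt nR u v w) := by
  set g : BipGraph nL nR → Fin nR → ℝ := fun H z =>
    edgeInd H u z * edgeInd H v z * edgeInd H w z with hg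
  have h : ∫ H, (∑ z, g H z - (∑ z, g H z) * (∑ z, g H z - 1) / 2) ∂chungLu wL wR ≤
      (chungLu wL wR).real (triangleAt nR u v w) := by
    refine integral_le_measureReal (fun H _ => ?_) fun H hH => ?_
    · obtain ⟨k, hk⟩ := exists_nat_eq_sum (edgeInd_mul_mul_eq_zero_or_one H u v w)
      simp only [hg, hk]
      exact nat_sub_choose_two_le_one k
    · have : ∑ z, g H z = 0 := by
        refine Finset.sum_eq_zero fun z _ => ?_
        by_contra hz
        have hu : H (u, z) = true := by
          by_contra hH
          exact hz (by simp [hg, edgeInd, hH])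
        have hv : H (v, z) = true := by
          by_contra hH
          exact hz (by simp [hg, edgeInd, hH])
        have hw : H (w, z) = true := by
          by_contra hH
          exact hz (by simp [hg, edgeInd, hH])
        exact hH ⟨⟨⟨huv, z, hu, hv⟩, huw, z, hu, hw⟩, hvw, z, hv, hw⟩
      simp [this]
  have h1 : ∫ H, ∑ z, g H z ∂chungLu wL wR = wL u * wL v * wL w * ∑ z, a z ^ 3 := by
    rw [integral_finsetSum _ fun _ _ => .of_finite, Finset.mul_sum]
    exact Finset.sum_congr rfl fun z _ => integral_star hp huv huw hvw z
  have h2 : ∫ H, (∑ z, g H z) * (∑ z, g H z - 1) ∂chungLu wL wR ≤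
      (wL u * wL v * wL w * ∑ z, a z ^ 3) ^ 2 := by
    simp_rw [fun H => sum_mul_sum_sub_one (g := g H) (edgeInd_mul_mul_eq_zero_or_one H u v w)]
    rw [integral_finsetSum _ fun _ _ => .of_finite, sq, Finset.mul_sum, Finset.sum_mul_sum]
    refine Finset.sum_le_sum fun z _ => ?_
    rw [integral_finsetSum _ fun _ _ => .of_finite]
    refine Finset.sum_le_sum fun z' _ => ?_
    by_cases hz : z = z'
    · subst hz
      simpa using mul_self_nonneg _
    · simp only [if_neg hz]
      exact (integral_star_mul_star hp huv huw hvw hz).le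
  rw [integral_sub .of_finite .of_finite, integral_div, h1] at h
  linarith

/-- Choose a right node witnessing each side. If two of them coincide, that node sees all three left
nodes; otherwise six distinct edges are present. -/
lemma measureReal_triangleAt_le (hp : ∀ u z, (edgeProb wL wR u z : ℝ) = wL u * a z)
    (huv : u ≠ v) (huw : u ≠ w) (hvw : v ≠ w) :
    (chungLu wL wR).real (triangleAt nR u v w) ≤
      wL u * wL v * wL w * ∑ z, a z ^ 3 +
        (wL u * wL v * wL w) ^ 2 * (∑ z, a z ^ 2) ^ 3 := by
  set t : BipGraph nL nR → Fin nR → Fin nR → Fin nR → ℝ := fun H z₁ z₂ z₃ =>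
    if z₁ ≠ z₂ ∧ z₁ ≠ z₃ ∧ z₂ ≠ z₃ then
      (edgeInd H u z₁ * edgeInd H v z₁) * (edgeInd H u z₂ * edgeInd H w z₂) *
        (edgeInd H v z₃ * edgeInd H w z₃) else 0 with ht
  set g : BipGraph nL nR → Fin nR → ℝ := fun H z =>
    edgeInd H u z * edgeInd H v z * edgeInd H w z with hg
  have hg0 (H z) : 0 ≤ g H z :=
    mul_nonneg (mul_nonneg (edgeInd_nonneg H u z) (edgeInd_nonneg H v z)) (edgeInd_nonneg H w z)
  have ht0 (H z₁ z₂ z₃) : 0 ≤ t H z₁ z₂ z₃ := by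
    have h := edgeInd_nonneg H
    simp only [ht]
    split_ifs
    · exact mul_nonneg (mul_nonneg (mul_nonneg (h _ _) (h _ _)) (mul_nonneg (h _ _) (h _ _)))
        (mul_nonneg (h _ _) (h _ _))
    · exact le_rfl
  have hgs (H) : 0 ≤ ∑ z, g H z := Finset.sum_nonneg fun z _ => hg0 H z
  have hts3 (H z₁ z₂) : 0 ≤ ∑ z₃, t H z₁ z₂ z₃ := Finset.sum_nonneg fun z _ => ht0 H _ _ z
  have hts2 (H z₁) : 0 ≤ ∑ z₂, ∑ z₃, t H z₁ z₂ z₃ := Finset.sum_nonneg fun z _ => hts3 H _ z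
  have hts (H) : 0 ≤ ∑ z₁, ∑ z₂, ∑ z₃, t H z₁ z₂ z₃ := Finset.sum_nonneg fun z _ => hts2 H z
  have key (H z) (hu : H (u, z) = true) (hv : H (v, z) = true) (hw : H (w, z) = true) :
      1 ≤ ∑ z, g H z := by
    have := Finset.single_le_sum (fun z _ => hg0 H z) (Finset.mem_univ z)
    simpa [hg, edgeInd_of_mem hu, edgeInd_of_mem hv, edgeInd_of_mem hw] using this
  have h : (chungLu wL wR).real (triangleAt nR u v w) ≤
      ∫ H, (∑ z, g H z + ∑ z₁, ∑ z₂, ∑ z₃, t H z₁ z₂ z₃) ∂chungLu wL wR := by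
    refine measureReal_le_integral ?_ fun H => add_nonneg (hgs H) (hts H)
    rintro H ⟨⟨⟨-, z₁, hu1, hv1⟩, -, z₂, hu2, hw2⟩, -, z₃, hv3, hw3⟩
    by_cases h12 : z₁ = z₂
    · subst h12
      exact le_add_of_le_of_nonneg (key H _ hu1 hv1 hw2) (hts H)
    by_cases h13 : z₁ = z₃
    · subst h13
      exact le_add_of_le_of_nonneg (key H _ hu1 hv1 hw3) (hts H)
    by_cases h23 : z₂ = z₃
    · subst h23
      exact le_add_of_le_of_nonneg (key H _ hu2 hv3 hw2) (hts H)
    refine le_add_of_nonneg_of_le (hgs H) ?_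
    calc (1 : ℝ) = t H z₁ z₂ z₃ := by
          simp [ht, h12, h13, h23, edgeInd_of_mem hu1, edgeInd_of_mem hv1, edgeInd_of_mem hu2,
            edgeInd_of_mem hw2, edgeInd_of_mem hv3, edgeInd_of_mem hw3]
      _ ≤ ∑ z₃, t H z₁ z₂ z₃ :=
          Finset.single_le_sum (fun z _ => ht0 H z₁ z₂ z) (Finset.mem_univ z₃)
      _ ≤ ∑ z₂, ∑ z₃, t H z₁ z₂ z₃ :=
          Finset.single_le_sum (fun z _ => hts3 H z₁ z) (Finset.mem_univ z₂)
      _ ≤ ∑ z₁, ∑ z₂, ∑ z₃, t H z₁ z₂ z₃ :=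
          Finset.single_le_sum (fun z _ => hts2 H z) (Finset.mem_univ z₁)
  have h1 : ∫ H, ∑ z, g H z ∂chungLu wL wR = wL u * wL v * wL w * ∑ z, a z ^ 3 := by
    rw [integral_finsetSum _ fun _ _ => .of_finite, Finset.mul_sum]
    exact Finset.sum_congr rfl fun z _ => integral_star hp huv huw hvw z
  have h2 : ∫ H, ∑ z₁, ∑ z₂, ∑ z₃, t H z₁ z₂ z₃ ∂chungLu wL wR ≤
      (wL u * wL v * wL w) ^ 2 * (∑ z, a z ^ 2) ^ 3 := by
    have e : (wL u * wL v * wL w) ^ 2 * (∑ z, a z ^ 2) ^ 3 =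
        ∑ z₁, ∑ z₂, ∑ z₃, (wL u * wL v * wL w) ^ 2 * (a z₁ ^ 2 * a z₂ ^ 2 * a z₃ ^ 2) := by
      simp only [← Finset.mul_sum, ← Finset.sum_mul]
      ring
    rw [e, integral_finsetSum _ fun _ _ => .of_finite]
    refine Finset.sum_le_sum fun z₁ _ => ?_
    rw [integral_finsetSum _ fun _ _ => .of_finite]
    refine Finset.sum_le_sum fun z₂ _ => ?_
    rw [integral_finsetSum _ fun _ _ => .of_finite]
    refine Finset.sum_le_sum fun z₃ _ => ?_
    simp only [ht]
    split_ifs with hz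
    · exact (integral_triangle hp huv huw hvw hz.1 hz.2.1 hz.2.2).le
    · simp only [integral_zero]
      positivity
  rw [integral_add .of_finite .of_finite, h1] at h
  linarith

end Bounds

end BipartiteProjection

namespace BipartiteProjection

/-! ### Relative error for a fixed pair. -/

section PairEstimate

lemma abs_sub_mul_le_of_bounds {A B N D r η : ℝ} (hA : 0 ≤ A) (hB : 0 ≤ B) (hη : 0 ≤ η)
    (hη' : η ≤ 1 / 6) (hr0 : 0 ≤ r) (hr : r * (A + B) = A) (hN : A * (1 - η) ≤ N)
    (hN' : N ≤ A + η * B) (hD : (A + B) * (1 - 3 * η) ≤ D) (hD' : D ≤ A + B) :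
    |N - r * D| ≤ 6 * η * D := by
  have h1 : r * ((A + B) * (1 - 3 * η)) ≤ r * D := mul_le_mul_of_nonneg_left hD hr0
  have h2 : r * D ≤ r * (A + B) := mul_le_mul_of_nonneg_left hD' hr0
  have h3 : r * ((A + B) * (1 - 3 * η)) = A * (1 - 3 * η) := by rw [← mul_assoc, hr]
  have hηA : 0 ≤ η * A := mul_nonneg hη hA
  have hηB : 0 ≤ η * B := mul_nonneg hη hB
  -- `η ≤ 1 / 6` makes `1 - 3 * η ≥ 1 / 2`; this turns an error `3 * η * (A + B)` into `6 * η * D`.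
  have h4 : (A + B) / 2 ≤ D := by
    have : (A + B) / 2 ≤ (A + B) * (1 - 3 * η) := by
      have := mul_le_mul_of_nonneg_left hη' (add_nonneg hA hB)
      linarith
    linarith
  have h5 : 3 * η * (A + B) ≤ 6 * η * D := by
    have := mul_le_mul_of_nonneg_left h4 hη
    linarith
  rw [abs_le]
  constructor <;> linarith

variable {nL nR : ℕ} {wL : Fin nL → ℝ} {wR : Fin nR → ℝ} {a : Fin nR → ℝ} {W η : ℝ}

lemma mul_le_of_sq_mul_sum_sq_le (hη : 0 ≤ η) (hS : W ^ 2 * ∑ z, a z ^ 2 ≤ η ^ 2)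
    {x : ℝ} (hx : 0 ≤ x) (hxW : x ≤ W) (z : Fin nR) : x * a z ≤ η := by
  refine le_of_sq_le_sq ?_ hη
  calc (x * a z) ^ 2 = x ^ 2 * a z ^ 2 := by ring
    _ ≤ W ^ 2 * ∑ z, a z ^ 2 := by
      gcongr
      exact Finset.single_le_sum (f := fun z => a z ^ 2) (fun z _ => sq_nonneg _)
        (Finset.mem_univ z)
    _ ≤ η ^ 2 := hS

lemma mul_sum_pow_succ_le (hη : 0 ≤ η) (ha : ∀ z, 0 ≤ a z)
    (hS : W ^ 2 * ∑ z, a z ^ 2 ≤ η ^ 2) {x : ℝ} (hx : 0 ≤ x) (hxW : x ≤ W) (k : ℕ) :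
    x * ∑ z, a z ^ (k + 1) ≤ η * ∑ z, a z ^ k := by
  rw [Finset.mul_sum, Finset.mul_sum]
  refine Finset.sum_le_sum fun z _ => ?_
  calc x * a z ^ (k + 1) = x * a z * a z ^ k := by ring
    _ ≤ η * a z ^ k := mul_le_mul_of_nonneg_right (mul_le_of_sq_mul_sum_sq_le hη hS hx hxW z)
      (pow_nonneg (ha z) k)

/-- Each error term is `A` or `B` times a factor at most `η`: `x y S₂` and its analogues, `A`
itself, or `x S₄ / S₃`. -/
lemma measureReal_triangleAt_sub_le (hp : ∀ u z, (edgeProb wL wR u z : ℝ) = wL u * a z)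
    (hw : ∀ u, 0 < wL u) (ha : ∀ z, 0 ≤ a z) (hW : ∀ u, wL u ≤ W) (hη : 0 ≤ η)
    (hη' : η ≤ 1 / 6) (hS : W ^ 2 * ∑ z, a z ^ 2 ≤ η ^ 2) (h3 : 0 < ∑ z, a z ^ 3)
    {u v w : Fin nL} (huv : u ≠ v) (huw : u ≠ w) (hvw : v ≠ w) :
    0 < (chungLu wL wR).real (wedgeAt nR u v w) ∧
    |(chungLu wL wR).real (triangleAt nR u v w) -
      (∑ z, a z ^ 3) / (∑ z, a z ^ 3 + wL u * (∑ z, a z ^ 2) ^ 2) *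
        (chungLu wL wR).real (wedgeAt nR u v w)| ≤
      6 * η * (chungLu wL wR).real (wedgeAt nR u v w) := by
  have hN := le_measureReal_triangleAt hp huv huw hvw
  have hN' := measureReal_triangleAt_le hp huv huw hvw
  have hD := le_measureReal_wedgeAt hp (fun u => (hw u).le) ha huv huw hvw
  have hD' := measureReal_wedgeAt_le hp (fun u => (hw u).le) huv huw hvw
  have h4 := mul_sum_pow_succ_le hη ha hS (hw u).le (hW u) 3
  have h32 := mul_sum_pow_succ_le hη ha hS (hw w).le (hW w) 2
  norm_num at h4 h32
  have hη1 : η ^ 2 ≤ η := by nlinarith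
  have h2 : 0 ≤ ∑ z, a z ^ 2 := Finset.sum_nonneg fun z _ => sq_nonneg _
  have hprod (u v) : wL u * wL v * ∑ z, a z ^ 2 ≤ η := by
    refine le_trans ?_ (hS.trans hη1)
    rw [sq]
    have := (hw u).le.trans (hW u)
    gcongr
    · exact (hw v).le
    · exact hW u
    · exact hW v
  have hxy := hprod u v
  have hxt := hprod u w
  have hyt := hprod v w
  have hx := hw u
  have hy := hw v
  have ht := hw w
  generalize wL u = x at *
  generalize wL v = y at *
  generalize wL w = t at *
  generalize ∑ z, a z ^ 2 = S₂ at *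
  generalize ∑ z, a z ^ 3 = S₃ at *
  generalize ∑ z, a z ^ 4 = S₄ at *
  have hxyt : 0 < x * y * t := by positivity
  obtain ⟨A, hA⟩ : ∃ A, A = x * y * t * S₃ := ⟨_, rfl⟩
  obtain ⟨B, hB⟩ : ∃ B, B = x ^ 2 * y * t * S₂ ^ 2 := ⟨_, rfl⟩
  have hA0 : 0 < A := by rw [hA]; positivity
  have hB0 : 0 ≤ B := by rw [hB]; positivity
  have hAη : A ≤ η := by
    have h1 : x * y * (t * S₃) ≤ x * y * (η * S₂) := mul_le_mul_of_nonneg_left h32 (by positivity)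
    have h2 : η * (x * y * S₂) ≤ η * η := mul_le_mul_of_nonneg_left hxy hη
    nlinarith
  have e4 : x ^ 2 * y * t * S₄ ≤ η * A := by
    have := mul_le_mul_of_nonneg_left h4 hxyt.le
    rw [hA]; linarith
  have eA (s : ℝ) (h : s ≤ η) : A * s ≤ η * A := by
    rw [mul_comm]; exact mul_le_mul_of_nonneg_right h hA0.le
  have eB (s : ℝ) (h : s ≤ η) : B * s ≤ η * B := by
    rw [mul_comm]; exact mul_le_mul_of_nonneg_right h hB0
  have e1 := eA _ hxy
  have e2 := eA _ hxt
  have e3 := eB _ hxy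
  have e5 := eB _ hxt
  have e6 := eB _ hyt
  have e7 := eA _ hAη
  have i1 : x ^ 2 * y ^ 2 * t * (S₃ * S₂) = A * (x * y * S₂) := by rw [hA]; ring
  have i2 : x ^ 2 * t ^ 2 * y * (S₃ * S₂) = A * (x * t * S₂) := by rw [hA]; ring
  have i3 : x ^ 3 * y ^ 2 * t * S₂ ^ 3 = B * (x * y * S₂) := by rw [hB]; ring
  have i4 : x ^ 3 * t ^ 2 * y * S₂ ^ 3 = B * (x * t * S₂) := by rw [hB]; ring
  have i5 : (x * y * t) ^ 2 * S₂ ^ 3 = B * (y * t * S₂) := by rw [hB]; ring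
  rw [i1, i2, i3, i4, ← hA, ← hB] at hD
  rw [← hA, ← hB] at hD'
  rw [i5, ← hA] at hN'
  rw [← hA] at hN
  have hηA : 0 ≤ η * A := by positivity
  have hηB : 0 ≤ η * B := by positivity
  -- The loss is `η A` from `S₄`, `2 η A` from the `S₃ S₂` terms and `η B` from the `S₂ ^ 3` terms.
  have hDl : (A + B) * (1 - 3 * η) ≤ (chungLu wL wR).real (wedgeAt nR u v w) := by linarith
  refine ⟨lt_of_lt_of_le (mul_pos (by positivity) (by linarith)) hDl,
    abs_sub_mul_le_of_bounds hA0.le hB0 hη hη' (by positivity) ?_ ?_ ?_ hDl hD'⟩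
  · have : S₃ + x * S₂ ^ 2 ≠ 0 := by positivity
    rw [hA, hB]
    field_simp
  · linarith
  · linarith

end PairEstimate

/-! ### From fixed pairs to the clustering coefficient. -/

section Clustering

variable {nL nR : ℕ} {wL : Fin nL → ℝ} {wR : Fin nR → ℝ}

lemma measureReal_pairLaw (u : Fin nL) (E : Set (BipGraph nL nR × (Fin nL × Fin nL))) :
    (pairLaw wL wR u).real E = ∫ p, (chungLu wL wR).real {H | (H, p) ∈ E}
      ∂uniformOn {p : Fin nL × Fin nL | p.1 ≠ p.2 ∧ p.1 ≠ u ∧ p.2 ≠ u} := by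
  rw [measureReal_def, pairLaw, Measure.prod_apply_symm E.toFinite.measurableSet,
    ← integral_toReal (Measurable.of_discrete).aemeasurable (by simp [measure_lt_top])]
  rfl

lemma nonempty_pairs (h : 3 ≤ nL) (u : Fin nL) :
    {p : Fin nL × Fin nL | p.1 ≠ p.2 ∧ p.1 ≠ u ∧ p.2 ≠ u}.Nonempty := by
  have h1 : 1 < (Finset.univ.erase u).card := by
    rw [Finset.card_erase_of_mem (Finset.mem_univ u), Finset.card_univ, Fintype.card_fin]
    omega
  obtain ⟨v, hv, w, hw, hvw⟩ := Finset.one_lt_card.mp h1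
  exact ⟨(v, w), hvw, (Finset.mem_erase.mp hv).1, (Finset.mem_erase.mp hw).1⟩

/-- An approximation of the clustering probability that is valid for every pair `(v, w)` carries
over to the local clustering coefficient. -/
lemma abs_localClustering_sub_le (hnL : 3 ≤ nL) {u : Fin nL} {r c : ℝ}
    (h : ∀ v w, u ≠ v → u ≠ w → v ≠ w → 0 < (chungLu wL wR).real (wedgeAt nR u v w) ∧
      |(chungLu wL wR).real (triangleAt nR u v w) -
        r * (chungLu wL wR).real (wedgeAt nR u v w)| ≤
        c * (chungLu wL wR).real (wedgeAt nR u v w)) :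
    |localClustering wL wR u - r| ≤ c := by
  set P := {p : Fin nL × Fin nL | p.1 ≠ p.2 ∧ p.1 ≠ u ∧ p.2 ≠ u} with hP
  have : IsProbabilityMeasure (uniformOn P) :=
    isProbabilityMeasure_uniformOn P.toFinite (nonempty_pairs hnL u)
  have hmem : ∀ᵐ p ∂uniformOn P, p ∈ P := ae_cond_mem P.toFinite.measurableSet
  have hD : (pairLaw wL wR u).real (wedgeEvent nR u) =
      ∫ p, (chungLu wL wR).real (wedgeAt nR u p.1 p.2) ∂uniformOn P := measureReal_pairLaw u _
  have hN : (pairLaw wL wR u).real (wedgeEvent nR u ∩ closedEvent nL nR) =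
      ∫ p, (chungLu wL wR).real (triangleAt nR u p.1 p.2) ∂uniformOn P := measureReal_pairLaw u _
  have hDpos : 0 < (pairLaw wL wR u).real (wedgeEvent nR u) := by
    refine lt_of_le_of_ne measureReal_nonneg fun h0 => ?_
    rw [hD, eq_comm, integral_eq_zero_iff_of_nonneg (fun _ => measureReal_nonneg) .of_finite] at h0
    obtain ⟨p, hp, hp0⟩ := (hmem.and h0).exists
    exact (h p.1 p.2 hp.2.1.symm hp.2.2.symm hp.1).1.ne' hp0
  have key : |(pairLaw wL wR u).real (wedgeEvent nR u ∩ closedEvent nL nR) -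
      r * (pairLaw wL wR u).real (wedgeEvent nR u)| ≤
      c * (pairLaw wL wR u).real (wedgeEvent nR u) := by
    rw [hD, hN, ← integral_const_mul, ← integral_const_mul, ← integral_sub .of_finite .of_finite]
    refine (abs_integral_le_integral_abs).trans (integral_mono_ae .of_finite .of_finite ?_)
    filter_upwards [hmem] with p hp
    exact (h p.1 p.2 hp.2.1.symm hp.2.2.symm hp.1).2
  have e : localClustering wL wR u = (pairLaw wL wR u).real (wedgeEvent nR u ∩ closedEvent nL nR) /
      (pairLaw wL wR u).real (wedgeEvent nR u) := by
    rw [localClustering, measureReal_def, cond_apply (Set.toFinite _).measurableSet,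
      ENNReal.toReal_mul, ENNReal.toReal_inv, inv_mul_eq_div]
    rfl
  rw [e, div_sub' hDpos.ne', abs_div, abs_of_pos hDpos, div_le_iff₀ hDpos, mul_comm _ r]
  exact key

/-- The quotient in the limit formula in terms of the normalized right weights. -/
lemma limit_eq (hpos : 0 < ∑ v, wR v) (hw : ∀ v, 0 ≤ wR v) (x : ℝ) (hx : 0 ≤ x) :
    0 < ∑ z, (wR z / ∑ v, wR v) ^ 3 ∧
    1 / (1 + weightMoment wR 2 ^ 2 / (weightMoment wR 3 * weightMoment wR 1) * x) =
      (∑ z, (wR z / ∑ v, wR v) ^ 3) /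
        (∑ z, (wR z / ∑ v, wR v) ^ 3 + x * (∑ z, (wR z / ∑ v, wR v) ^ 2) ^ 2) := by
  obtain ⟨z, -, hz⟩ := (Finset.sum_pos_iff_of_nonneg fun v _ => hw v).mp hpos
  have hn : (0 : ℝ) < nR := by exact_mod_cast z.pos
  have h3 : 0 < ∑ v, wR v ^ 3 :=
    (Finset.sum_pos_iff_of_nonneg fun v _ => pow_nonneg (hw v) 3).mpr
      ⟨z, Finset.mem_univ z, by positivity⟩
  simp only [weightMoment, div_pow, ← Finset.sum_div, pow_one]
  generalize ∑ v, wR v ^ 3 = P₃ at *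
  generalize ∑ v, wR v = P₁ at *
  generalize ∑ v, wR v ^ 2 = P₂ at *
  refine ⟨by positivity, ?_⟩
  have e1 : P₃ * P₁ + x * P₂ ^ 2 ≠ 0 := by positivity
  have e2 : 1 + (P₂ / nR) ^ 2 / (P₃ / nR * (P₁ / nR)) * x = (P₃ * P₁ + x * P₂ ^ 2) / (P₃ * P₁) := by
    field_simp
  have e3 : P₃ / P₁ ^ 3 + x * (P₂ / P₁ ^ 2) ^ 2 = (P₃ * P₁ + x * P₂ ^ 2) / P₁ ^ 4 := by
    field_simp
  rw [div_pow] at e2 e3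
  rw [e2, e3]
  field_simp

/-- A quantitative form of the limit formula for finite weight sequences. -/
lemma abs_localClustering_sub_limit_le (hnL : 3 ≤ nL) (hwL : ∀ u, 0 < wL u)
    (hwR : ∀ v, 0 ≤ wR v) (hpos : 0 < ∑ v, wR v) {W η : ℝ} (hW : ∀ u, wL u ≤ W) (hη : 0 ≤ η)
    (hη' : η ≤ 1 / 6) (hS : W ^ 2 * ∑ z, (wR z / ∑ v, wR v) ^ 2 ≤ η ^ 2) (u : Fin nL) :
    |localClustering wL wR u -
      1 / (1 + weightMoment wR 2 ^ 2 / (weightMoment wR 3 * weightMoment wR 1) * wL u)| ≤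
      6 * η := by
  obtain ⟨h3, e⟩ := limit_eq hpos hwR (wL u) (hwL u).le
  have ha (z) : 0 ≤ wR z / ∑ v, wR v := div_nonneg (hwR z) hpos.le
  -- The truncation at 1 is inactive because `wL u * a z ≤ η ≤ 1`.
  have hp (u z) : (edgeProb wL wR u z : ℝ) = wL u * (wR z / ∑ v, wR v) := by
    have h1 : wL u * (wR z / ∑ v, wR v) ≤ 1 :=
      (mul_le_of_sq_mul_sum_sq_le hη hS (hwL u).le (hW u) z).trans (by linarith)
    rw [edgeProb, mul_div_assoc, Set.projIcc_of_mem _ ⟨mul_nonneg (hwL u).le (ha z), h1⟩]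
  rw [e]
  exact abs_localClustering_sub_le hnL fun v w huv huw hvw =>
    measureReal_triangleAt_sub_le hp hwL ha hW hη hη' hS h3 huv huw hvw

end Clustering

/-! ### The smallness parameter tends to zero. -/

section Asymptotic

variable {ι : Type*} {l : Filter ι} {nL nR : ι → ℕ}
    {wL : ∀ i, Fin (nL i) → ℝ} {wR : ∀ i, Fin (nR i) → ℝ} {δ : ℝ}

/-- The sum equals `M_{R2} / (n_R M_{R1}²) = O(1 / n_R)`, while the squared maximum is `O(n_R ^ (1 -
2δ))`. -/
lemma tendsto_max_sq_mul_sum_sq (hnR : Tendsto nR l atTop) (hpos : ∀ i, 0 < ∑ v, wR i v)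
    (hδ : 0 < δ)
    (hmax : (fun i => max (⨆ u, wL i u) (⨆ v, wR i v)) =O[l] fun i => (nR i : ℝ) ^ (1 / 2 - δ))
    (h2 : (fun i => weightMoment (wR i) 2) =O[l] fun i => weightMoment (wR i) 1 ^ 2) :
    Tendsto (fun i => max (⨆ u, wL i u) (⨆ v, wR i v) ^ 2 *
      ∑ z, (wR i z / ∑ v, wR i v) ^ 2) l (𝓝 0) := by
  have hn : Tendsto (fun i => (nR i : ℝ)) l atTop := tendsto_natCast_atTop_atTop.comp hnR
  have hlim : Tendsto (fun i => (nR i : ℝ) ^ (-(2 * δ))) l (𝓝 0) :=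
    (tendsto_rpow_neg_atTop (by positivity)).comp hn
  have hsum : (fun i => ∑ z, (wR i z / ∑ v, wR i v) ^ 2) =O[l] fun i => ((nR i : ℝ))⁻¹ := by
    refine ((h2.mul (isBigO_refl (fun i => (weightMoment (wR i) 1 ^ 2 * nR i)⁻¹) l)).congr' ?_ ?_)
    all_goals
      filter_upwards [hn.eventually_gt_atTop 0] with i hi
      have := hpos i
      simp only [weightMoment, pow_one, div_pow, ← Finset.sum_div]
      field_simp
  refine ((hmax.pow 2).mul hsum).trans_tendsto (hlim.congr' ?_)
  filter_upwards [hn.eventually_gt_atTop 0] with i hi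
  rw [← Real.rpow_natCast, ← Real.rpow_mul hi.le, ← Real.rpow_neg_one, ← Real.rpow_add hi]
  congr 1
  push_cast
  ring

end Asymptotic

end BipartiteProjection

theorem mainTheorem1 {ι : Type*} (l : Filter ι) (nL nR : ι → ℕ)
    (hnL : Tendsto nL l atTop) (hnR : Tendsto nR l atTop)
    (wL : ∀ i, Fin (nL i) → ℝ) (wR : ∀ i, Fin (nR i) → ℝ)
    (hwL : ∀ i u, 0 ≤ wL i u) (hwR : ∀ i v, 0 ≤ wR i v) (hpos : ∀ i, 0 < ∑ v, wR i v)
    (δ : ℝ) (hδ : 1 / 10 < δ) (hbdd : BoundedWeights l wL wR δ) :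
    ∀ ε : ℝ, 0 < ε → ∀ᶠ i in l, ∀ u : Fin (nL i),
      |localClustering (wL i) (wR i) u -
        1 / (1 + weightMoment (wR i) 2 ^ 2 /
          (weightMoment (wR i) 3 * weightMoment (wR i) 1) * wL i u)| < ε := by
  intro ε hε
  obtain ⟨η, hη, hη', hηε⟩ : ∃ η : ℝ, 0 < η ∧ η ≤ 1 / 6 ∧ 6 * η < ε :=
    ⟨min (1 / 6) (ε / 12), by positivity, min_le_left _ _, by
      have := min_le_right (1 / 6) (ε / 12)
      linarith⟩
  have hlim := tendsto_max_sq_mul_sum_sq hnR hpos (by linarith) hbdd.range_max hbdd.moment_two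
  obtain ⟨c, hc⟩ := hbdd.left_min.bound
  filter_upwards [hnL.eventually_ge_atTop 3, hlim.eventually_le_const (pow_pos hη 2), hc]
    with i h3 hS hmin u
  -- A zero weight would make the infimum zero, and `left_min` would read `1 ≤ c * 0`. Positivity
  -- keeps the conditioning event from being null.
  have hwL' (u) : 0 < wL i u := by
    refine lt_of_le_of_ne (hwL i u) fun h0 => ?_
    have h1 : ⨅ u, wL i u = 0 :=
      le_antisymm ((ciInf_le (Set.finite_range _).bddBelow u).trans h0.ge)
        (Real.iInf_nonneg (hwL i))
    rw [h1] at hmin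
    norm_num at hmin
  exact (abs_localClustering_sub_limit_le h3 hwL' (hwR i) (hpos i)
    (fun u => (le_ciSup (Set.finite_range _).bddAbove u).trans (le_max_left _ _))
    hη.le hη' hS u).trans_lt hηε
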